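/- Let $d \ge 2$ and let $\mathbf n = (n_1,\dots,n_d) \in \mathbb Z_{>0}^d$ be a velocity vector, that is, its entries are positive, pairwise distinct and relatively prime ($\gcd(n_1,\dots,n_d)=1$). Let $$Z_{\mathbf n} = \mathrm{Zon}(\mathbf e_1,\dots,\mathbf e_d,\mathbf n) = [\mathbf 0,\mathbf e_1] + \dots + [\mathbf 0,\mathbf e_d] + [\mathbf 0,\mathbf n] \subseteq \mathbb R^d$$ be the associated lonely runner zonotope (a Minkowski sum of segments, $\mathbf e_i$ being the standard unit vectors). Then $$\mathrm{vol}(Z_{\mathbf n}) = 1 + n_1 + \dots + n_d,$$ $$\#\bigl(\mathrm{int}(Z_{\mathbf n}) \cap \mathbb Z^d\bigr) = \sum_{\substack{\ell \in \mathbb N,\ \ell \mid n_j \\ \text{for some } j \in \{1,\dots,d\}}} \varphi(\ell),$$ $$\#\bigl(Z_{\mathbf n} \cap \mathbb Z^d\bigr) = 2^d + \sum_{\substack{\ell \in \mathbb N,\ \ell \mid n_j \\ \text{for some } j \in \{1,\dots,d\}}} \varphi(\ell)\,\bigl(2^{\# J_\ell} - 1\bigr),$$ where $\varphi$ is Euler's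 totient function and $J_\ell$ is the inclusion-wise maximal subset $J \subseteq \{1,\dots,d\}$ with $\ell \mid n_j$ for all $j \in J$, i.e. $J_\ell = \{ j : \ell \mid n_j \}$. -/

import Mathlib

open scoped Pointwise ENNReal

/-- A velocity vector: at least two entries, all of them positive integers, pairwise distinct, and
(jointly) relatively prime. -/
structure IsVelocityVector {d : ℕ} (n : Fin d → ℕ) : Prop where
  two_le : 2 ≤ d
  pos : ∀ i, 0 < n i
  distinct : Function.Injective n
  coprime : Finset.univ.gcd n = 1

/-- The zonotope generated by `g 0, …, g (m - 1)` in `ℝ^d`: the Minkowski sum of the segments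
`[0, g j]`. -/
def Zon {d m : ℕ} (g : Fin m → (Fin d → ℝ)) : Set (Fin d → ℝ) :=
  ∑ j, segment ℝ 0 (g j)

/-- The generators `e_1, …, e_d, n` of the lonely runner zonotope, in this order. -/
def lonelyRunnerGenerators {d : ℕ} (n : Fin d → ℕ) : Fin (d + 1) → (Fin d → ℝ) :=
  Fin.snoc (α := fun _ => Fin d → ℝ) (fun i => Pi.single i 1) (fun i => (n i : ℝ))

/-- The lonely runner zonotope `Zon(e_1, …, e_d, n)`. -/
def lonelyRunnerZonotope {d : ℕ} (n : Fin d → ℕ) : Set (Fin d → ℝ) :=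
  Zon (lonelyRunnerGenerators n)

/-- The integer lattice `ℤ^d` inside `ℝ^d`. -/
def integerLattice (d : ℕ) : Set (Fin d → ℝ) :=
  Set.range fun (z : Fin d → ℤ) (i : Fin d) => (z i : ℝ)

/-- The natural numbers dividing at least one entry of `n`, for `n` with positive entries. -/
def entryDivisors {d : ℕ} (n : Fin d → ℕ) : Finset ℕ :=
  Finset.univ.biUnion fun j => (n j).divisors

/-- The largest set of indices `J` such that `ℓ` divides `n j` for all `j ∈ J`. -/
def divisibleIndices {d : ℕ} (n : Fin d → ℕ) (ℓ : ℕ) : Finset (Fin d) :=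
  {j | ℓ ∣ n j}

/-!
The zonotope is swept out by the unit cube as it moves from `0` to `n`. Record each point outside
the initial cube by the time `t ∈ (0, 1]` at which the moving cube first reaches it, through a
facet `x i = t * n i + 1`. For the volume, the set swept out by the `i`-th such facet has measure
`n i`, and these sets overlap in null sets. An integer point can be reached at time `t` only if
some `t * n i` is an integer, that is, if `t` is a reduced fraction `a / ℓ` with `ℓ` dividing some
`n i`; there are `φ ℓ` such times for each `ℓ`. At time `a / ℓ`, the `i`-th coordinate of an integer
point of the cube has two possible values if `ℓ ∣ n i` and one otherwise, and of these
`2 ^ #J_ℓ` points all but the smallest are new. The interior points are instead recorded by the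
time at which the cube leaves them behind, and at time `a / ℓ` it leaves behind exactly one.
-/

open MeasureTheory Set Function Topology

section Minkowski

theorem closure_add_subset_closure_add {E : Type*} [TopologicalSpace E] [Add E] [ContinuousAdd E]
    (s t : Set E) : closure s + t ⊆ closure (s + t) := by
  rintro _ ⟨x, hx, y, hy, rfl⟩
  exact map_mem_closure (f := (· + y)) (continuous_add_const y) hx fun z hz => add_mem_add hz hy

theorem interior_add_eq_interior_add {E : Type*} [AddCommGroup E] [Module ℝ E] [TopologicalSpace E]
    [IsTopologicalAddGroup E] [ContinuousSMul ℝ E] {s t : Set E} (hs : Convex ℝ s)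
    (ht : Convex ℝ t) (hne : (interior s).Nonempty) : interior (s + t) = interior s + t := by
  have hopen : IsOpen (interior s + t) := isOpen_interior.add_right
  refine subset_antisymm ?_ (interior_maximal (add_subset_add_right interior_subset) hopen)
  rcases t.eq_empty_or_nonempty with rfl | htne
  · simp
  calc interior (s + t) ⊆ interior (closure (interior s) + t) := by
        rw [hs.closure_interior_eq_closure_of_nonempty_interior hne]
        exact interior_mono (add_subset_add_right subset_closure)
    _ ⊆ interior (closure (interior s + t)) := interior_mono (closure_add_subset_closure_add _ _)
    _ = interior s + t := by
        rw [(hs.interior.add ht).interior_closure_eq_interior_of_nonempty_interior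
          (by rw [hopen.interior_eq]; exact hne.add htne), hopen.interior_eq]

theorem mem_add_segment_zero {E : Type*} [AddCommGroup E] [Module ℝ E] {s : Set E} {v x : E} :
    x ∈ s + segment ℝ 0 v ↔ ∃ t ∈ Icc (0 : ℝ) 1, x - t • v ∈ s := by
  rw [segment_eq_image', add_comm, mem_add]
  simp only [exists_mem_image, sub_zero, zero_add]
  exact exists_congr fun t => and_congr_right fun _ =>
    ⟨by rintro ⟨y, hy, rfl⟩; simpa, fun h => ⟨_, h, add_sub_cancel _ _⟩⟩

end Minkowski

section SweptBox

variable {ι : Type*} [Fintype ι]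

theorem parallelepiped_update_single [DecidableEq ι] (c v : ι → ℝ) (i : ι) :
    parallelepiped (update (fun j => Pi.single j (c j)) i v) =
      uIcc 0 (update c i 0) + segment ℝ 0 v := by
  have hbox : uIcc 0 (update c i 0) =
      ∑ j ∈ Finset.univ.erase i, segment ℝ (0 : ι → ℝ) (Pi.single j (c j)) := by
    rw [← parallelepiped_single, parallelepiped_eq_sum_segment,
      ← Finset.add_sum_erase _ _ (Finset.mem_univ i)]
    rw [update_self, Pi.single_zero, segment_same, singleton_zero, zero_add]
    exact Finset.sum_congr rfl fun j hj => by rw [update_of_ne (Finset.ne_of_mem_erase hj)]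
  rw [parallelepiped_eq_sum_segment, ← Finset.add_sum_erase _ _ (Finset.mem_univ i), update_self,
    add_comm, hbox]
  congr 1
  exact Finset.sum_congr rfl fun j hj => by rw [update_of_ne (Finset.ne_of_mem_erase hj)]

theorem volume_parallelepiped [DecidableEq ι] (u : ι → ι → ℝ) :
    volume (parallelepiped u) = ENNReal.ofReal |(Matrix.of u).det| := by
  have hvol : (Pi.basisFun ℝ ι).addHaar = volume := by
    rw [Module.Basis.addHaar, Module.Basis.parallelepiped_basisFun, addHaarMeasure_eq_volume_pi]
  rw [← hvol, Measure.addHaar_parallelepiped, Pi.basisFun_det]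
  rfl

theorem det_updateRow_diagonal {R : Type*} [CommRing R] [DecidableEq ι] (c v : ι → R) (i : ι) :
    ((Matrix.diagonal c).updateRow i v).det = (∏ j ∈ Finset.univ.erase i, c j) * v i := by
  rw [← Matrix.cramer_transpose_apply, Matrix.diagonal_transpose,
    Matrix.cramer_eq_adjugate_mulVec, Matrix.adjugate_diagonal, Matrix.mulVec_diagonal]

theorem volume_Icc_add_segment [DecidableEq ι] {a b : ι → ℝ} (hab : a ≤ b) {i : ι}
    (hi : a i = b i) (v : ι → ℝ) :
    volume (Icc a b + segment ℝ 0 v) =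
      ENNReal.ofReal |(∏ j ∈ Finset.univ.erase i, (b - a) j) * v i| := by
  have hbox : Icc a b = a +ᵥ uIcc 0 (update (b - a) i 0) := by
    rw [update_eq_self_iff.2 (by simp [hi]), uIcc_of_le (sub_nonneg.2 hab), ← image_vadd]
    simp
  have hmatrix : Matrix.of (update (fun j => Pi.single j ((b - a) j)) i v) =
      (Matrix.diagonal (b - a)).updateRow i v := by
    ext j k
    rcases eq_or_ne j i with rfl | hj
    · simp
    · simp [hj, Matrix.diagonal_apply, Pi.single_apply, eq_comm]
  rw [hbox, vadd_add_assoc, measure_vadd, ← parallelepiped_update_single, volume_parallelepiped,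
    hmatrix, det_updateRow_diagonal]

end SweptBox

/-- The union of the facets of the cube `Icc a (a + 1)` whose outer normal is some `e i`. -/
def upperFaces {ι : Type*} (a : ι → ℝ) : Set (ι → ℝ) :=
  {x ∈ Icc a (a + 1) | ∃ i, x i = a i + 1}

/-- The part of the half-open cube `Ico a (a + 1)` that lies on some facet with outer normal
`-e i`; the product of half-open intervals is spelled out, since `Set.Ico` in a product is
defined by the strict product order. -/
def lowerFaces {ι : Type*} (a : ι → ℝ) : Set (ι → ℝ) :=
  {x ∈ univ.pi fun i => Ico (a i) (a i + 1) | ∃ i, x i = a i}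

/-- The zonotope `[0, 1]^ι + [0, v]`, swept out by the unit cube as it is translated along `v`. -/
def sweptCube {ι : Type*} (v : ι → ℝ) : Set (ι → ℝ) :=
  Icc 0 1 + segment ℝ 0 v

/-- The set swept out by the facet `x i = 1` of the unit cube as it is translated along `v`. -/
def sweptFacet {ι : Type*} [DecidableEq ι] (v : ι → ℝ) (i : ι) : Set (ι → ℝ) :=
  Icc (Pi.single i 1) 1 + segment ℝ 0 v

section SweptCube

variable {ι : Type*} {v x : ι → ℝ}

theorem sub_mem_Icc_zero_one_iff {a : ι → ℝ} : x - a ∈ Icc 0 1 ↔ x ∈ Icc a (a + 1) := by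
  simp [add_comm]

theorem mem_sweptCube :
    x ∈ sweptCube v ↔ ∃ t ∈ Icc (0 : ℝ) 1, x ∈ Icc (t • v) (t • v + 1) := by
  simp only [sweptCube, mem_add_segment_zero, sub_mem_Icc_zero_one_iff]

theorem sub_mem_Icc_single_one_iff [DecidableEq ι] {a : ι → ℝ} {i : ι} :
    x - a ∈ Icc (Pi.single i 1) 1 ↔ x ∈ Icc a (a + 1) ∧ x i = a i + 1 := by
  have hlower : Pi.single i 1 ≤ x - a ↔ 1 ≤ (x - a) i ∧ ∀ j ≠ i, 0 ≤ (x - a) j := update_le_iff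
  rw [← sub_mem_Icc_zero_one_iff, ← sub_eq_iff_eq_add', mem_Icc, hlower]
  constructor
  · rintro ⟨⟨hi, hne⟩, hle⟩
    refine ⟨⟨fun j => ?_, hle⟩, (hle i).antisymm hi⟩
    rcases eq_or_ne j i with rfl | hj
    exacts [zero_le_one.trans hi, hne j hj]
  · rintro ⟨⟨hnonneg, hle⟩, hi⟩
    exact ⟨⟨hi.ge, fun j _ => hnonneg j⟩, hle⟩

theorem mem_sweptFacet [DecidableEq ι] {i : ι} :
    x ∈ sweptFacet v i ↔
      ∃ t ∈ Icc (0 : ℝ) 1, x ∈ Icc (t • v) (t • v + 1) ∧ x i = (t • v) i + 1 := by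
  simp only [sweptFacet, mem_add_segment_zero, sub_mem_Icc_single_one_iff]

theorem exists_smul_le_and_eq [Finite ι] [Nonempty ι] (hv : ∀ i, 0 < v i) (x : ι → ℝ) :
    ∃ t : ℝ, t • v ≤ x ∧ ∃ i, x i = t * v i := by
  obtain ⟨i, hi⟩ := Finite.exists_min fun i => x i / v i
  exact ⟨x i / v i, fun j => (le_div_iff₀ (hv j)).1 (hi j), i,
    (div_mul_cancel₀ _ (hv i).ne').symm⟩

theorem exists_le_smul_add_one_and_eq [Finite ι] [Nonempty ι] (hv : ∀ i, 0 < v i) (x : ι → ℝ) :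
    ∃ t : ℝ, x ≤ t • v + 1 ∧ ∃ i, x i = t * v i + 1 := by
  obtain ⟨t, hle, i, hi⟩ := exists_smul_le_and_eq hv (1 - x)
  refine ⟨-t, ?_, i, ?_⟩
  · rw [neg_smul, neg_add_eq_sub]
    exact le_sub_comm.1 hle
  · simp only [Pi.sub_apply, Pi.one_apply] at hi
    linarith

theorem pairwise_disjoint_upperFaces (hv : ∀ i, 0 < v i) :
    Pairwise (Disjoint on fun t : ℝ => upperFaces (t • v)) := by
  refine (pairwise_disjoint_on _).2 fun s t hst => disjoint_left.2 ?_
  rintro x ⟨hx, -⟩ ⟨-, i, hi⟩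
  have hle : x i ≤ s * v i + 1 := hx.2 i
  have hlt : s * v i < t * v i := mul_lt_mul_of_pos_right hst (hv i)
  simp only [Pi.smul_apply, smul_eq_mul] at hi
  linarith

theorem pairwise_disjoint_lowerFaces (hv : ∀ i, 0 < v i) :
    Pairwise (Disjoint on fun t : ℝ => lowerFaces (t • v)) := by
  refine (pairwise_disjoint_on _).2 fun s t hst => disjoint_left.2 ?_
  rintro x ⟨-, i, hi⟩ ⟨hx, -⟩
  have hle : t * v i ≤ x i := (hx i trivial).1
  have hlt : s * v i < t * v i := mul_lt_mul_of_pos_right hst (hv i)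
  simp only [Pi.smul_apply, smul_eq_mul] at hi
  linarith

theorem disjoint_unitCube_iUnion_upperFaces (hv : ∀ i, 0 < v i) :
    Disjoint (Icc 0 1) (⋃ t ∈ Ioc (0 : ℝ) 1, upperFaces (t • v)) := by
  simp only [disjoint_iUnion_right]
  refine fun t ht => disjoint_left.2 ?_
  rintro x hx ⟨-, i, hi⟩
  have hle : x i ≤ 1 := hx.2 i
  have hpos : 0 < t * v i := mul_pos ht.1 (hv i)
  simp only [Pi.smul_apply, smul_eq_mul] at hi
  linarith

theorem sweptCube_eq_unitCube_union_iUnion_upperFaces [Finite ι] (hv : ∀ i, 0 < v i) :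
    sweptCube v = Icc 0 1 ∪ ⋃ t ∈ Ioc (0 : ℝ) 1, upperFaces (t • v) := by
  refine subset_antisymm (fun x hx => ?_) (union_subset (fun x hx => ?_) ?_)
  · obtain ⟨t, ht, hx⟩ := mem_sweptCube.1 hx
    refine or_iff_not_imp_left.2 fun hcube => ?_
    have hx0 : 0 ≤ x := (smul_nonneg ht.1 fun i => (hv i).le).trans hx.1
    obtain ⟨k, hk⟩ : ∃ k, 1 < x k := by
      by_contra! h
      exact hcube ⟨hx0, h⟩
    have : Nonempty ι := ⟨k⟩
    -- `s` is the time at which the moving cube first reaches `x`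
    obtain ⟨s, hle, i, hi⟩ := exists_le_smul_add_one_and_eq hv x
    have hs0 : 0 < s := by
      have hxk : x k ≤ s * v k + 1 := hle k
      exact pos_of_mul_pos_left (by linarith : 0 < s * v k) (hv k).le
    have hst : s ≤ t := by
      have hxi : x i ≤ t * v i + 1 := hx.2 i
      exact le_of_mul_le_mul_right (by linarith) (hv i)
    exact mem_biUnion (show s ∈ Ioc 0 1 from ⟨hs0, hst.trans ht.2⟩)
      ⟨⟨(smul_le_smul_of_nonneg_right hst fun i => (hv i).le).trans hx.1, hle⟩, i, hi⟩
  · exact mem_sweptCube.2 ⟨0, by simp, by simpa using hx⟩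
  · exact iUnion₂_subset fun t ht x hx => mem_sweptCube.2 ⟨t, Ioc_subset_Icc_self ht, hx.1⟩

theorem sweptCube_eq_unitCube_union_iUnion_sweptFacet [Finite ι] [DecidableEq ι]
    (hv : ∀ i, 0 < v i) : sweptCube v = Icc 0 1 ∪ ⋃ i, sweptFacet v i := by
  apply subset_antisymm
  · rw [sweptCube_eq_unitCube_union_iUnion_upperFaces hv]
    refine union_subset_union_right _ (iUnion₂_subset ?_)
    rintro t ht x ⟨hx, i, hi⟩
    exact mem_iUnion.2 ⟨i, mem_sweptFacet.2 ⟨t, Ioc_subset_Icc_self ht, hx, hi⟩⟩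
  · refine union_subset (fun x hx => mem_sweptCube.2 ⟨0, by simp, by simpa using hx⟩)
      (iUnion_subset fun i => ?_)
    exact add_subset_add_right (Icc_subset_Icc_left (Pi.single_nonneg.2 zero_le_one))

theorem mem_interior_sweptCube [Finite ι] :
    x ∈ interior (sweptCube v) ↔
      ∃ t ∈ Icc (0 : ℝ) 1, ∀ i, x i ∈ Ioo (t * v i) (t * v i + 1) := by
  have hcube : interior (Icc (0 : ι → ℝ) 1) = univ.pi fun _ => Ioo 0 1 := by
    simp [← pi_univ_Icc, interior_pi_set finite_univ]
  have hne : (interior (Icc (0 : ι → ℝ) 1)).Nonempty := by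
    simp [hcube, univ_pi_nonempty_iff]
  rw [sweptCube, interior_add_eq_interior_add (convex_Icc 0 1) (convex_segment 0 v) hne, hcube,
    mem_add_segment_zero]
  simp [sub_lt_iff_lt_add']

/-- Rewinding the motion slightly turns the weak inequalities into strict ones. -/
theorem mem_interior_sweptCube_of_mem_Ico [Finite ι] (hv : ∀ i, 0 < v i) {t : ℝ}
    (ht : t ∈ Ioc (0 : ℝ) 1) (hx : ∀ i, x i ∈ Ico (t * v i) (t * v i + 1)) :
    x ∈ interior (sweptCube v) := by
  have hlt : ∀ᶠ s in 𝓝[<] t, ∀ i, x i < s * v i + 1 := by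
    refine Filter.eventually_all.2 fun i => nhdsWithin_le_nhds ?_
    exact ContinuousAt.eventually_lt (by fun_prop) (by fun_prop) (hx i).2
  obtain ⟨s, hs, hs0, hst⟩ := (hlt.and (Ioo_mem_nhdsLT ht.1)).exists
  refine mem_interior_sweptCube.2 ⟨s, ⟨hs0.le, hst.le.trans ht.2⟩, fun i => ⟨?_, hs i⟩⟩
  exact (mul_lt_mul_of_pos_right hst (hv i)).trans_le (hx i).1

variable [DecidableEq ι]

theorem single_one_le_one (i : ι) : (Pi.single i 1 : ι → ℝ) ≤ 1 :=
  update_le_iff.2 ⟨le_rfl, fun _ _ => zero_le_one⟩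

theorem isCompact_sweptFacet (i : ι) : IsCompact (sweptFacet v i) := by
  refine isCompact_Icc.add ?_
  rw [segment_eq_image']
  exact isCompact_Icc.image (by fun_prop)

variable [Fintype ι]

theorem volume_sweptFacet {i : ι} (hi : 0 ≤ v i) :
    volume (sweptFacet v i) = ENNReal.ofReal (v i) := by
  have hsides : ∏ j ∈ Finset.univ.erase i, (1 - Pi.single i 1 : ι → ℝ) j = 1 :=
    Finset.prod_eq_one fun j hj => by simp [Finset.ne_of_mem_erase hj]
  rw [sweptFacet, volume_Icc_add_segment (single_one_le_one i) (Pi.single_eq_same i 1), hsides,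
    one_mul, abs_of_nonneg hi]

theorem aedisjoint_unitCube_sweptFacet {i : ι} (hi : 0 < v i) :
    AEDisjoint volume (Icc 0 1) (sweptFacet v i) := by
  refine measure_mono_null (t := Icc (Pi.single i 1) 1) ?_ ?_
  · rintro x ⟨hx, hx'⟩
    obtain ⟨t, ht, -, hxi⟩ := mem_sweptFacet.1 hx'
    have hge : 0 ≤ t * v i := mul_nonneg ht.1 hi.le
    rw [← sub_zero x, sub_mem_Icc_single_one_iff]
    have hxi' : x i = 1 := (hx.2 i).antisymm (by simpa [hxi] using hge)
    exact ⟨by simpa using hx, by simpa using hxi'⟩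
  · rw [Real.volume_Icc_pi]
    exact Finset.prod_eq_zero (Finset.mem_univ i) (by simp)

theorem pairwise_aedisjoint_sweptFacet (hv : ∀ i, 0 < v i) :
    Pairwise (AEDisjoint volume on sweptFacet v) := by
  intro i j hij
  refine measure_mono_null
    (t := Icc (Pi.single i 1 ⊔ Pi.single j 1) 1 + segment ℝ 0 v) ?_ ?_
  · rintro x ⟨hxi, hxj⟩
    obtain ⟨s, hs, hxs⟩ := mem_add_segment_zero.1 hxi
    obtain ⟨t, -, hxt⟩ := mem_add_segment_zero.1 hxj
    have hs' := sub_mem_Icc_single_one_iff.1 hxs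
    have ht' := sub_mem_Icc_single_one_iff.1 hxt
    obtain rfl : s = t := (pairwise_disjoint_upperFaces hv).eq
      (not_disjoint_iff.2 ⟨x, ⟨hs'.1, i, hs'.2⟩, ⟨ht'.1, j, ht'.2⟩⟩)
    exact mem_add_segment_zero.2 ⟨s, hs, sup_le hxs.1 hxt.1, hxs.2⟩
  · have hside : ∏ k ∈ Finset.univ.erase i, (1 - Pi.single i 1 ⊔ Pi.single j 1 : ι → ℝ) k = 0 :=
      Finset.prod_eq_zero (Finset.mem_erase.2 ⟨hij.symm, Finset.mem_univ j⟩) (by simp [hij.symm])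
    rw [volume_Icc_add_segment (sup_le (single_one_le_one i) (single_one_le_one j))
      (i := i) (by simp [hij]), hside]
    simp

end SweptCube

theorem volume_sweptCube {ι : Type*} [Fintype ι] {v : ι → ℝ} (hv : ∀ i, 0 < v i) :
    volume (sweptCube v) = 1 + ∑ i, ENNReal.ofReal (v i) := by
  classical
  have hnull (i : ι) : NullMeasurableSet (sweptFacet v i) volume :=
    (isCompact_sweptFacet i).measurableSet.nullMeasurableSet
  rw [sweptCube_eq_unitCube_union_iUnion_sweptFacet hv,
    measure_union₀ (.iUnion hnull) (AEDisjoint.iUnion_right_iff.2 fun i =>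
      aedisjoint_unitCube_sweptFacet (hv i)),
    measure_iUnion₀ (pairwise_aedisjoint_sweptFacet hv) hnull, tsum_fintype, Real.volume_Icc_pi]
  simp [volume_sweptFacet (hv _).le]

section RationalTimes

/-- The rational numbers in `(0, 1]` whose reduced denominator is `ℓ`. -/
def reducedFractions (ℓ : ℕ) : Finset ℚ :=
  ((Finset.Ico 1 (1 + ℓ)).filter ℓ.Coprime).image fun a : ℕ => (a : ℚ) / ℓ

theorem den_natCast_div_of_coprime {ℓ a : ℕ} (hℓ : 0 < ℓ) (h : ℓ.Coprime a) :
    ((a : ℚ) / ℓ).den = ℓ := by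
  have hden := Rat.den_div_eq_of_coprime (a := a) (Int.natCast_pos.2 hℓ) h.symm
  simpa only [Int.cast_natCast, Nat.cast_inj] using hden

theorem mem_reducedFractions {ℓ : ℕ} {s : ℚ} :
    s ∈ reducedFractions ℓ ↔ s ∈ Ioc 0 1 ∧ s.den = ℓ := by
  simp only [reducedFractions, Finset.mem_image, Finset.mem_filter, Finset.mem_Ico]
  constructor
  · rintro ⟨a, ⟨⟨ha, haℓ⟩, hcop⟩, rfl⟩
    have hℓ : (0 : ℚ) < ℓ := by exact_mod_cast (by lia : 0 < ℓ)
    refine ⟨⟨div_pos (by exact_mod_cast ha) hℓ, (div_le_one hℓ).2 ?_⟩,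
      den_natCast_div_of_coprime (by lia) hcop⟩
    exact_mod_cast (by lia : a ≤ ℓ)
  · rintro ⟨⟨hpos, hle⟩, rfl⟩
    have hnum : 0 < s.num := Rat.num_pos.2 hpos
    have hnum_le : s.num ≤ s.den := by
      rw [← Rat.num_div_den s, div_le_one (by exact_mod_cast s.den_pos)] at hle
      exact_mod_cast hle
    refine ⟨s.num.natAbs, ⟨by lia, s.reduced.symm⟩, ?_⟩
    rw [Nat.cast_natAbs, abs_of_pos hnum, Rat.num_div_den]

theorem card_reducedFractions (ℓ : ℕ) : (reducedFractions ℓ).card = ℓ.totient := by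
  rw [reducedFractions, Finset.card_image_of_injOn, Nat.filter_coprime_Ico_eq_totient]
  intro a ha b _ h
  have hℓ : (ℓ : ℚ) ≠ 0 := by
    rw [Finset.mem_coe, Finset.mem_filter, Finset.mem_Ico] at ha
    exact_mod_cast (by lia : ℓ ≠ 0)
  exact_mod_cast (div_left_inj' hℓ).1 h

theorem den_dvd_iff_mul_mem_range_intCast {s : ℚ} {m : ℕ} :
    s.den ∣ m ↔ (s : ℝ) * m ∈ range ((↑) : ℤ → ℝ) := by
  constructor
  · rintro ⟨k, rfl⟩
    refine ⟨s.num * k, ?_⟩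
    have h : (s * s.den : ℚ) = s.num := s.mul_den_eq_num
    have h' : (s : ℝ) * s.den = s.num := by exact_mod_cast h
    push_cast
    rw [← mul_assoc, h']
  · rintro ⟨z, hz⟩
    have hnum : s.num * m = s.den * z := by
      have hq : (z : ℚ) = s * m := by exact_mod_cast hz
      have hq' : (s.num * m : ℚ) = s.den * z := by
        rw [hq, ← s.mul_den_eq_num]
        ring
      exact_mod_cast hq'
    exact_mod_cast s.isCoprime_num_den.symm.dvd_of_dvd_mul_left
      (Dvd.intro _ hnum.symm)

theorem exists_ratCast_eq_and_den_dvd {t : ℝ} {m : ℕ} (hm : 0 < m)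
    (h : t * m ∈ range ((↑) : ℤ → ℝ)) : ∃ s : ℚ, (s : ℝ) = t ∧ s.den ∣ m := by
  obtain ⟨z, hz⟩ := h
  have ht : ((z / m : ℚ) : ℝ) = t := by
    push_cast
    rw [hz, mul_div_cancel_right₀]
    exact_mod_cast hm.ne'
  exact ⟨z / m, ht, den_dvd_iff_mul_mem_range_intCast.2 ⟨z, by rw [ht, hz]⟩⟩

theorem encard_iUnion_Ioc_zero_one {α : Type*} {A : ℝ → Set α} (hA : Pairwise (Disjoint on A))
    {D : Finset ℕ} {f : ℕ → ℕ} (hrat : ∀ t, (A t).Nonempty → ∃ s : ℚ, (s : ℝ) = t ∧ s.den ∈ D)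
    (hcard : ∀ s : ℚ, s.den ∈ D → (A s).encard = f s.den) :
    (⋃ t ∈ Ioc (0 : ℝ) 1, A t).encard = ((∑ ℓ ∈ D, ℓ.totient * f ℓ : ℕ) : ℕ∞) := by
  have hunion : ⋃ t ∈ Ioc (0 : ℝ) 1, A t =
      ⋃ s ∈ (D.biUnion reducedFractions : Set ℚ), A (s : ℝ) := by
    ext x
    simp only [mem_iUnion₂, Finset.mem_coe, Finset.mem_biUnion, mem_reducedFractions]
    constructor
    · rintro ⟨t, ht, hx⟩
      obtain ⟨s, rfl, hs⟩ := hrat t ⟨x, hx⟩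
      exact ⟨s, ⟨_, hs, ⟨by exact_mod_cast ht.1, by exact_mod_cast ht.2⟩, rfl⟩, hx⟩
    · rintro ⟨s, ⟨_, -, hs, -⟩, hx⟩
      exact ⟨s, ⟨by exact_mod_cast hs.1, by exact_mod_cast hs.2⟩, hx⟩
  have hdisj : (D : Set ℕ).PairwiseDisjoint reducedFractions := fun ℓ _ m _ hne =>
    Finset.disjoint_left.2 fun s hs hs' =>
      hne ((mem_reducedFractions.1 hs).2.symm.trans (mem_reducedFractions.1 hs').2)
  rw [hunion, (Finset.finite_toSet _).encard_biUnion (s := fun s : ℚ => A s) fun s _ s' _ hne =>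
    hA (Rat.cast_injective.ne hne), finsum_mem_coe_finset, Finset.sum_biUnion hdisj, Nat.cast_sum]
  refine Finset.sum_congr rfl fun ℓ hℓ => ?_
  have hconst : ∀ s ∈ reducedFractions ℓ, (A s).encard = f ℓ := by
    intro s hs
    obtain ⟨-, rfl⟩ := mem_reducedFractions.1 hs
    exact hcard s hℓ
  rw [Finset.sum_eq_card_nsmul hconst, card_reducedFractions, nsmul_eq_mul, Nat.cast_mul]

end RationalTimes

/-- The integer points of a set `A ⊆ ℝ^ι`, as elements of `ℤ^ι`. -/
def integerPoints {ι : Type*} (A : Set (ι → ℝ)) : Set (ι → ℤ) :=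
  (fun z i => (z i : ℝ)) ⁻¹' A

section IntegerPoints

variable {ι : Type*} {a : ι → ℝ} {z : ι → ℤ}

theorem mem_integerPoints_Icc :
    z ∈ integerPoints (Icc a (a + 1)) ↔ ∀ i, ⌈a i⌉ ≤ z i ∧ z i ≤ ⌊a i⌋ + 1 := by
  simp [integerPoints, Pi.le_def, Int.ceil_le, ← Int.floor_add_one, Int.le_floor, forall_and]

theorem encard_integerPoints_Icc [Finite ι] {J : Finset ι}
    (hJ : ∀ i, i ∈ J ↔ a i ∈ range ((↑) : ℤ → ℝ)) :
    (integerPoints (Icc a (a + 1))).encard = ((2 ^ J.card : ℕ) : ℕ∞) := by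
  classical
  have := Fintype.ofFinite ι
  have hIcc : integerPoints (Icc a (a + 1)) =
      (Finset.Icc (fun i => ⌈a i⌉) (fun i => ⌊a i⌋ + 1) : Finset (ι → ℤ)) := by
    ext z
    simp [mem_integerPoints_Icc, Pi.le_def, forall_and]
  have hcard (i : ι) : (Finset.Icc ⌈a i⌉ (⌊a i⌋ + 1)).card = if i ∈ J then 2 else 1 := by
    rw [Int.card_Icc]
    split_ifs with hi
    · obtain ⟨m, hm⟩ := (hJ i).1 hi
      rw [← hm, Int.ceil_intCast, Int.floor_intCast]
      lia
    · rw [(Int.ceil_eq_floor_add_one_iff_notMem _).2 (mt (hJ i).2 hi)]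
      lia
  rw [hIcc, encard_coe_eq_coe_finsetCard, Pi.card_Icc]
  simp [hcard, Finset.prod_ite_mem]

theorem integerPoints_upperFaces :
    integerPoints (upperFaces a) = integerPoints (Icc a (a + 1)) \ {fun i => ⌈a i⌉} := by
  ext z
  refine and_congr_right fun hz => ?_
  have hz' := mem_integerPoints_Icc.1 hz
  rw [mem_singleton_iff, funext_iff, not_forall]
  refine exists_congr fun i => ⟨fun h hi => ?_, fun h => (hz.2 i).antisymm ?_⟩
  · have hceil := Int.ceil_lt_add_one (a i)
    rw [← hi, ← h] at hceil
    exact hceil.false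
  · have hlt : ⌈a i⌉ + 1 ≤ z i := (hz' i).1.lt_of_ne (Ne.symm h)
    calc a i + 1 ≤ (⌈a i⌉ + 1 : ℤ) := by
          push_cast
          gcongr
          exact Int.le_ceil _
      _ ≤ z i := by exact_mod_cast hlt

theorem encard_integerPoints_upperFaces [Finite ι] {J : Finset ι}
    (hJ : ∀ i, i ∈ J ↔ a i ∈ range ((↑) : ℤ → ℝ)) :
    (integerPoints (upperFaces a)).encard = ((2 ^ J.card - 1 : ℕ) : ℕ∞) := by
  rw [integerPoints_upperFaces, encard_sdiff_singleton_of_mem, encard_integerPoints_Icc hJ]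
  · norm_cast
  · exact mem_integerPoints_Icc.2 fun i => ⟨le_rfl, Int.ceil_le_floor_add_one _⟩

theorem encard_integerPoints_lowerFaces (h : ∃ i, a i ∈ range ((↑) : ℤ → ℝ)) :
    (integerPoints (lowerFaces a)).encard = 1 := by
  have hIco (z : ι → ℤ) : (∀ i, (z i : ℝ) ∈ Ico (a i) (a i + 1)) ↔ z = fun i => ⌈a i⌉ := by
    simp only [funext_iff, mem_Ico, eq_comm (a := z _), Int.ceil_eq_iff, sub_lt_iff_lt_add,
      and_comm]
  refine encard_eq_one.2 ⟨fun i => ⌈a i⌉, eq_singleton_iff_unique_mem.2 ⟨⟨?_, ?_⟩, ?_⟩⟩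
  · exact fun i _ => (hIco _).2 rfl i
  · obtain ⟨i, m, hm⟩ := h
    refine ⟨i, ?_⟩
    simp only [← hm, Int.ceil_intCast]
  · exact fun z hz => (hIco z).1 fun i => hz.1 i trivial

theorem integerPoints_interior_sweptCube [Finite ι] [Nonempty ι] {n : ι → ℕ}
    (hn : ∀ i, 0 < n i) :
    integerPoints (interior (sweptCube fun i => (n i : ℝ))) =
      ⋃ t ∈ Ioc (0 : ℝ) 1, integerPoints (lowerFaces (t • fun i => (n i : ℝ))) := by
  have hv (i : ι) : (0 : ℝ) < n i := by exact_mod_cast hn i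
  refine subset_antisymm (fun z hz => ?_) (iUnion₂_subset fun t ht z hz => ?_)
  · obtain ⟨t, ht, hz⟩ := mem_interior_sweptCube.1 hz
    obtain ⟨s, hle, i, hi⟩ := exists_smul_le_and_eq hv fun i => (z i : ℝ)
    have hts : t < s := by
      have hlt : t * n i < z i := (hz i).1
      exact lt_of_mul_lt_mul_right (hlt.trans_eq hi) (hv i).le
    have hs : s ≤ 1 := by
      have hzn : z i < n i + 1 := by
        have h : (z i : ℝ) < n i + 1 := by
          linarith [(hz i).2, mul_le_of_le_one_left (hv i).le ht.2]
        exact_mod_cast h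
      have hzn' : (z i : ℝ) ≤ n i := by exact_mod_cast Int.lt_add_one_iff.1 hzn
      exact le_of_mul_le_mul_right (hi.symm.le.trans (hzn'.trans_eq (one_mul _).symm)) (hv i)
    refine mem_biUnion (show s ∈ Ioc 0 1 from ⟨ht.1.trans_lt hts, hs⟩)
      ⟨fun j _ => ⟨hle j, (hz j).2.trans ?_⟩, i, hi⟩
    gcongr
    exact mul_lt_mul_of_pos_right hts (hv j)
  · exact mem_interior_sweptCube_of_mem_Ico hv ht fun i => hz.1 i trivial

end IntegerPoints

section LonelyRunner

variable {d : ℕ} {n : Fin d → ℕ}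

theorem mem_entryDivisors (hn : ∀ i, 0 < n i) {ℓ : ℕ} :
    ℓ ∈ entryDivisors n ↔ ∃ i, ℓ ∣ n i := by
  simp [entryDivisors, (hn _).ne']

theorem mem_divisibleIndices_den {s : ℚ} (i : Fin d) :
    i ∈ divisibleIndices n s.den ↔
      ((s : ℝ) • fun i => (n i : ℝ)) i ∈ range ((↑) : ℤ → ℝ) := by
  rw [divisibleIndices, Finset.mem_filter_univ, den_dvd_iff_mul_mem_range_intCast, Pi.smul_apply,
    smul_eq_mul]

theorem exists_ratCast_eq_and_den_mem_entryDivisors (hn : ∀ i, 0 < n i) {t : ℝ}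
    (h : ∃ i, t * n i ∈ range ((↑) : ℤ → ℝ)) :
    ∃ s : ℚ, (s : ℝ) = t ∧ s.den ∈ entryDivisors n := by
  obtain ⟨i, hi⟩ := h
  obtain ⟨s, hs, hdvd⟩ := exists_ratCast_eq_and_den_dvd (hn i) hi
  exact ⟨s, hs, (mem_entryDivisors hn).2 ⟨i, hdvd⟩⟩

theorem encard_integerPoints_interior_sweptCube (hd : 0 < d) (hn : ∀ i, 0 < n i) :
    (integerPoints (interior (sweptCube fun i => (n i : ℝ)))).encard =
      ((∑ ℓ ∈ entryDivisors n, ℓ.totient : ℕ) : ℕ∞) := by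
  have hv (i : Fin d) : (0 : ℝ) < n i := by exact_mod_cast hn i
  have : Nonempty (Fin d) := ⟨⟨0, hd⟩⟩
  rw [integerPoints_interior_sweptCube hn]
  refine (encard_iUnion_Ioc_zero_one (D := entryDivisors n) (f := 1) ?_ ?_ ?_).trans (by simp)
  · exact fun s t hst => (pairwise_disjoint_lowerFaces hv hst).preimage _
  · rintro t ⟨z, -, i, hi⟩
    exact exists_ratCast_eq_and_den_mem_entryDivisors hn ⟨i, z i, hi⟩
  · intro s hs
    obtain ⟨i, hi⟩ := (mem_entryDivisors hn).1 hs
    exact encard_integerPoints_lowerFaces ⟨i, den_dvd_iff_mul_mem_range_intCast.1 hi⟩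

theorem encard_integerPoints_sweptCube (hn : ∀ i, 0 < n i) :
    (integerPoints (sweptCube fun i => (n i : ℝ))).encard =
      ((2 ^ d + ∑ ℓ ∈ entryDivisors n,
        ℓ.totient * (2 ^ (divisibleIndices n ℓ).card - 1) : ℕ) : ℕ∞) := by
  have hv (i : Fin d) : (0 : ℝ) < n i := by exact_mod_cast hn i
  have hcube : (integerPoints (Icc (0 : Fin d → ℝ) 1)).encard = ((2 ^ d : ℕ) : ℕ∞) := by
    have h := encard_integerPoints_Icc (a := (0 : Fin d → ℝ)) (J := Finset.univ)
      fun i => by simp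
    rwa [zero_add, Finset.card_univ, Fintype.card_fin] at h
  have hfaces : (integerPoints (⋃ t ∈ Ioc (0 : ℝ) 1, upperFaces (t • fun i => (n i : ℝ)))).encard =
      ((∑ ℓ ∈ entryDivisors n, ℓ.totient * (2 ^ (divisibleIndices n ℓ).card - 1) : ℕ) : ℕ∞) := by
    rw [integerPoints, preimage_iUnion₂]
    refine encard_iUnion_Ioc_zero_one
      (fun s t hst => (pairwise_disjoint_upperFaces hv hst).preimage _) ?_
      fun s _ => encard_integerPoints_upperFaces mem_divisibleIndices_den
    rintro t ⟨z, -, i, hi⟩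
    refine exists_ratCast_eq_and_den_mem_entryDivisors hn ⟨i, z i - 1, ?_⟩
    push_cast
    exact sub_eq_of_eq_add hi
  rw [sweptCube_eq_unitCube_union_iUnion_upperFaces hv, integerPoints, preimage_union,
    encard_union_eq ((disjoint_unitCube_iUnion_upperFaces hv).preimage _), Nat.cast_add, ← hcube,
    ← hfaces]
  rfl

theorem lonelyRunnerZonotope_eq_sweptCube (n : Fin d → ℕ) :
    lonelyRunnerZonotope n = sweptCube fun i => (n i : ℝ) := by
  have hcube : ∑ i : Fin d, segment ℝ (0 : Fin d → ℝ) (Pi.single i 1) = Icc 0 1 := by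
    rw [← parallelepiped_eq_sum_segment, ← uIcc_of_le (zero_le_one' (Fin d → ℝ))]
    exact parallelepiped_single 1
  rw [lonelyRunnerZonotope, Zon, Fin.sum_univ_castSucc, sweptCube, ← hcube]
  simp only [lonelyRunnerGenerators, Fin.snoc_castSucc, Fin.snoc_last]

theorem encard_inter_integerLattice (A : Set (Fin d → ℝ)) :
    (A ∩ integerLattice d).encard = (integerPoints A).encard := by
  rw [integerLattice, ← image_preimage_eq_inter_range, integerPoints]
  exact (Int.cast_injective.comp_left).encard_image _

theorem theorem7p2_general (n : Fin d → ℕ) (hd : 0 < d) (hn : ∀ i, 0 < n i) :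
    volume (lonelyRunnerZonotope n) = 1 + ∑ i, (n i : ℝ≥0∞) ∧
    (interior (lonelyRunnerZonotope n) ∩ integerLattice d).encard =
      ((∑ ℓ ∈ entryDivisors n, ℓ.totient : ℕ) : ℕ∞) ∧
    (lonelyRunnerZonotope n ∩ integerLattice d).encard =
      ((2 ^ d + ∑ ℓ ∈ entryDivisors n,
        ℓ.totient * (2 ^ (divisibleIndices n ℓ).card - 1) : ℕ) : ℕ∞) := by
  simp only [encard_inter_integerLattice, lonelyRunnerZonotope_eq_sweptCube]
  refine ⟨?_, encard_integerPoints_interior_sweptCube hd hn, encard_integerPoints_sweptCube hn⟩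
  rw [volume_sweptCube fun i => Nat.cast_pos.2 (hn i)]
  simp only [ENNReal.ofReal_natCast]

end LonelyRunner

theorem theorem7p2 {d : ℕ} (n : Fin d → ℕ) (hn : IsVelocityVector n) :
    MeasureTheory.volume (lonelyRunnerZonotope n) = 1 + ∑ i, (n i : ℝ≥0∞) ∧
    (interior (lonelyRunnerZonotope n) ∩ integerLattice d).encard =
      ((∑ ℓ ∈ entryDivisors n, Nat.totient ℓ : ℕ) : ℕ∞) ∧
    (lonelyRunnerZonotope n ∩ integerLattice d).encard =
      ((2 ^ d + ∑ ℓ ∈ entryDivisors n,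
        Nat.totient ℓ * (2 ^ (divisibleIndices n ℓ).card - 1) : ℕ) : ℕ∞) := by
  exact theorem7p2_general n (zero_lt_two.trans_le hn.two_le) hn.pos
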